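/- Let $m\ge 1$ be an odd integer, $k\ge 0$ an integer and $\alpha\in\mathbb R$. Put $\beta=\alpha+k+\frac{m-1}{2}$ and $M=2^{k+\frac{m+1}{2}}\prod_{n=1}^{k+\frac{m-1}{2}}(\alpha+n)$. Let $(a)_n=a(a+1)\cdots(a+n-1)$ be the Pochhammer symbol, let $P_n^{(a,b)}$ be the Jacobi polynomials, $$P_n^{(a,b)}(x)=\sum_{j=0}^n\frac{(n+a+b+1)_j\,(a+j+1)_{n-j}}{j!\,(n-j)!}\Bigl(\frac{x-1}{2}\Bigr)^j ,$$ and let $Q_n^{(\beta)}$ be the polynomials given by $Q_0^{(\beta)}=1$ and $Q_{n+1}^{(\beta)}(z)=2(\beta-n)zQ_n^{(\beta)}(z)+(1+z^2)\,\partial_zQ_n^{(\beta)}(z)$. Further let $$a_{n,m,k}=\frac{(-i)^{n}(2k+m-n-2)!}{(2k+m-2n-1)!!\,(n-1)!},\qquad b_{n,m,k}=\frac{(-i)^{n+1}(2k+m-n-1)!}{(2k+m-2n-1)!!\,n!}.$$ Let $0<r<1$, let $x_0\in\mathbb R$ with $|x_0|<1-r$, and put $Z=x_0+ir$; complex powers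 are principal. Then the following identities hold, the series on the right being convergent. (i) If $(m,k)\neq(1,0)$, then $$\sum_{n=1}^{k+\frac{m-1}{2}}\frac{a_{n,m,k}}{r^{2k+m-n-1}}\left((1+Z^2)^{\beta-n}Q_n^{(\beta)}(Z)+(-1)^{n}(1+\overline Z^2)^{\beta-n}Q_n^{(\beta)}(\overline Z)\right)$$ $$=M\sum_{n=0}^\infty\frac{2^{2n}n!\,(\alpha-n+1)_n\,x_0^{2n}}{(2n)!}(1-r^2)^{\alpha-2n}P_n^{\left(k+\frac m2-1,\,\alpha-2n\right)}(1-2r^2).$$ (ii) In all cases $$\sum_{n=0}^{k+\frac{m-1}{2}}\frac{b_{n,m,k}}{r^{2k+m-n-1}}\left((1+Z^2)^{\beta-n}Q_n^{(\beta)}(Z)+(-1)^{n+1}(1+\overline Z^2)^{\beta-n}Q_n^{(\beta)}(\overline Z)\right)$$ $$=M\sum_{n=0}^\infty\frac{2^{2n+1}n!\,(\alpha-n)_{n+1}\,x_0^{2n+1}}{(2n+1)!}(1-r^2)^{\alpha-2n-1}\,r\,P_n^{\left(k+\frac m2,\,\alpha-2n-1\right)}(1-2r^2).$$ -/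

import Mathlib

/-- The Pochhammer symbol (rising factorial) `(a)_n = a (a + 1) ⋯ (a + n - 1)`. -/
noncomputable def pochhammerSymbol (a : ℝ) (n : ℕ) : ℝ :=
  ∏ i ∈ Finset.range n, (a + i)

/-- The Jacobi polynomial `P_n^{(a,b)}`, for arbitrary real parameters, in the form
`(a+1)_n / n! * ₂F₁(-n, n+a+b+1; a+1; (1-x)/2)` with the factor `(a+1)_n / (a+1)_j = (a+j+1)_{n-j}`
cancelled, so that no denominator depends on the parameters. -/
noncomputable def jacobiP (n : ℕ) (a b x : ℝ) : ℝ :=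
  ∑ j ∈ Finset.range (n + 1),
    pochhammerSymbol (n + a + b + 1) j * pochhammerSymbol (a + j + 1) (n - j)
      / ((j.factorial : ℝ) * ((n - j).factorial : ℝ)) * ((x - 1) / 2) ^ j

/-- The polynomials `Q_n^{(β)}` with real coefficients:
`Q_0 = 1`, `Q_{n+1} = 2 (β - n) z Q_n + (1 + z²) Q_n'`, so that
`∂_z^n (1 + z²)^β = (1 + z²)^(β - n) Q_n^{(β)}(z)`. -/
noncomputable def polyQ (β : ℝ) : ℕ → Polynomial ℝ
  | 0 => 1
  | n + 1 =>
      Polynomial.C (2 * (β - n)) * Polynomial.X * polyQ β n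
        + (1 + Polynomial.X ^ 2) * Polynomial.derivative (polyQ β n)

/-- `(1 + z²)^(β - n) Q_n^{(β)}(z)`, with the principal branch of the power. -/
noncomputable def powQ (β : ℝ) (n : ℕ) (z : ℂ) : ℂ :=
  (1 + z ^ 2) ^ ((β - n : ℝ) : ℂ) * Polynomial.aeval z (polyQ β n)

/-- `a_{n,m,k} = (-i)^n (2k+m-n-2)! / ((2k+m-2n-1)!! (n-1)!)`, used for `m` odd and
`1 ≤ n ≤ k + (m-1)/2`, where all the subtractions are exact. -/
noncomputable def coeffA (n m k : ℕ) : ℂ :=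
  (-Complex.I) ^ n * ((2 * k + m - n - 2).factorial : ℂ)
    / ((Nat.doubleFactorial (2 * k + m - 2 * n - 1) : ℂ) * ((n - 1).factorial : ℂ))

/-- `b_{n,m,k} = (-i)^(n+1) (2k+m-n-1)! / ((2k+m-2n-1)!! n!)`, used for `m` odd and
`0 ≤ n ≤ k + (m-1)/2`, where all the subtractions are exact. -/
noncomputable def coeffB (n m k : ℕ) : ℂ :=
  (-Complex.I) ^ (n + 1) * ((2 * k + m - n - 1).factorial : ℂ)
    / ((Nat.doubleFactorial (2 * k + m - 2 * n - 1) : ℂ) * (n.factorial : ℂ))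

/-- The scalar part of the closed formula, at `Z = x₀ + i r`, with `β = α + k + (m-1)/2`. -/
noncomputable def scalarSum (m k : ℕ) (β x₀ r : ℝ) : ℂ :=
  ∑ n ∈ Finset.Icc 1 (k + (m - 1) / 2),
    coeffA n m k / (r : ℂ) ^ (2 * k + m - n - 1) *
      (powQ β n (⟨x₀, r⟩ : ℂ) + (-1) ^ n * powQ β n (star (⟨x₀, r⟩ : ℂ)))

/-- The `ω`-part of the closed formula, at `Z = x₀ + i r`, with `β = α + k + (m-1)/2`. -/
noncomputable def omegaSum (m k : ℕ) (β x₀ r : ℝ) : ℂ :=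
  ∑ n ∈ Finset.Icc 0 (k + (m - 1) / 2),
    coeffB n m k / (r : ℂ) ^ (2 * k + m - n - 1) *
      (powQ β n (⟨x₀, r⟩ : ℂ) + (-1) ^ (n + 1) * powQ β n (star (⟨x₀, r⟩ : ℂ)))

/-- `M = 2^(k + (m+1)/2) ∏_{n=1}^{k+(m-1)/2} (α + n)`, for `m` odd. -/
noncomputable def constM (m k : ℕ) (α : ℝ) : ℝ :=
  2 ^ (k + (m + 1) / 2) * ∏ n ∈ Finset.Icc 1 (k + (m - 1) / 2), (α + n)

/-- The `n`-th term of the series in identity (i). -/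
noncomputable def evenTerm (m k : ℕ) (α x₀ r : ℝ) (n : ℕ) : ℝ :=
  2 ^ (2 * n) * (n.factorial : ℝ) * pochhammerSymbol (α - n + 1) n * x₀ ^ (2 * n)
      / ((2 * n).factorial : ℝ)
    * (1 - r ^ 2) ^ (α - 2 * n) * jacobiP n (k + m / 2 - 1) (α - 2 * n) (1 - 2 * r ^ 2)

/-- The `n`-th term of the series in identity (ii). -/
noncomputable def oddTerm (m k : ℕ) (α x₀ r : ℝ) (n : ℕ) : ℝ :=
  2 ^ (2 * n + 1) * (n.factorial : ℝ) * pochhammerSymbol (α - n) (n + 1) * x₀ ^ (2 * n + 1)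
      / ((2 * n + 1).factorial : ℝ)
    * (1 - r ^ 2) ^ (α - 2 * n - 1) * r * jacobiP n (k + m / 2) (α - 2 * n - 1) (1 - 2 * r ^ 2)

/-! Only `K = k + (m-1)/2` matters, so `m = 1` may be assumed. On the disc of radius `1 - r` about
`ir` the function `powQ β n` is the `n`-th derivative of `(1 + z²)^β`, and it equals its Taylor
series there. It has parity `(-1)^n`, and `star Z = -(-x₀ + ir)`, so the conjugate term expands
about the same centre. The signs in the two sums then cancel the odd powers of `x₀` in (i) and the
even powers in (ii).

What remains at each power of `x₀` is a finite sum of derivatives of `(1 + z²)^β` at `ir`, that is,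
of derivatives of `(1 - r²)^β` in `r`. The coefficients `b_{n,1,K}` are, up to phases, those of the
operator `(r⁻¹ ∂_r)^K r⁻¹` (`hasDerivAt_besselSum`, `coeffB_eq`), and it acts on the derivative of
order `2l + 1`. Two contiguous relations (`jacobiD_lower`, `jacobiD_raise`) show that this
derivative is a multiple of `r (1 - r²)^b P_l^{(1/2,b)}(1 - 2r²)`. Each `r⁻¹ ∂_r` then raises the
first parameter by one and lowers the second by one (`besselSum_eq_jacobiFun`). Both identities use
the same finite sum, `sum_coeffB_mul_powQ`.

This gives convergence of `M` times the series, which says nothing about the series itself when `M =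
0`. Summability therefore comes from comparison with a very negative parameter `-J`, for which `M ≠
0`. -/

/-! ### Pochhammer symbols and contiguous relations of Jacobi polynomials. -/

theorem pochhammerSymbol_zero (a : ℝ) : pochhammerSymbol a 0 = 1 := by
  simp [pochhammerSymbol]

theorem pochhammerSymbol_succ (a : ℝ) (n : ℕ) :
    pochhammerSymbol a (n + 1) = pochhammerSymbol a n * (a + n) := by
  simp [pochhammerSymbol, Finset.prod_range_succ]

theorem pochhammerSymbol_succ_left (a : ℝ) (n : ℕ) :
    pochhammerSymbol a (n + 1) = a * pochhammerSymbol (a + 1) n := by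
  rw [pochhammerSymbol, Finset.prod_range_succ', mul_comm, pochhammerSymbol]
  congr 1
  · simp
  · refine Finset.prod_congr rfl fun i _ => ?_
    push_cast
    ring

theorem pochhammerSymbol_add (a : ℝ) (n p : ℕ) :
    pochhammerSymbol a (n + p) = pochhammerSymbol a n * pochhammerSymbol (a + n) p := by
  rw [pochhammerSymbol, Finset.prod_range_add, pochhammerSymbol, pochhammerSymbol]
  congr 1
  refine Finset.prod_congr rfl fun i _ => ?_
  push_cast
  ring

/-- The coefficient of `((x - 1) / 2) ^ j` in `jacobiP n a b x`. -/
noncomputable def jacobiCoeff (n : ℕ) (a b : ℝ) (j : ℕ) : ℝ :=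
  pochhammerSymbol (n + a + b + 1) j * pochhammerSymbol (a + j + 1) (n - j)
    / ((j.factorial : ℝ) * ((n - j).factorial : ℝ))

theorem jacobiP_eq_sum (n : ℕ) (a b t : ℝ) :
    jacobiP n a b (1 - 2 * t) = ∑ j ∈ Finset.range (n + 1), jacobiCoeff n a b j * (-t) ^ j := by
  rw [jacobiP]
  refine Finset.sum_congr rfl fun j _ => ?_
  rw [jacobiCoeff]
  congr 2
  ring

theorem jacobiP_zero (a b x : ℝ) : jacobiP 0 a b x = 1 := by
  simp [jacobiP, pochhammerSymbol]

/-- The derivative of `t ↦ jacobiP n a b (1 - 2 * t)`. -/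
noncomputable def jacobiD (n : ℕ) (a b t : ℝ) : ℝ :=
  -∑ j ∈ Finset.range n, (j + 1) * jacobiCoeff n a b (j + 1) * (-t) ^ j

theorem hasDerivAt_jacobiP (n : ℕ) (a b t : ℝ) :
    HasDerivAt (fun t => jacobiP n a b (1 - 2 * t)) (jacobiD n a b t) t := by
  simp only [jacobiP_eq_sum]
  have h : ∀ j ∈ Finset.range (n + 1), HasDerivAt (fun t : ℝ => jacobiCoeff n a b j * (-t) ^ j)
      (jacobiCoeff n a b j * (j * (-t) ^ (j - 1) * -1)) t := fun j _ =>
    (((hasDerivAt_id t).neg).pow j).const_mul _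
  have h2 := HasDerivAt.fun_sum h
  refine h2.congr_deriv ?_
  rw [Finset.sum_range_succ', jacobiD, ← Finset.sum_neg_distrib]
  simp only [Nat.cast_zero, zero_mul, mul_zero, add_zero, Nat.add_sub_cancel]
  refine Finset.sum_congr rfl fun j _ => ?_
  push_cast
  ring

theorem jacobiCoeff_lower_top (n : ℕ) (a b : ℝ) :
    jacobiCoeff n (a + 1) (b - 1) n = jacobiCoeff n a b n := by
  simp only [jacobiCoeff, Nat.sub_self, pochhammerSymbol_zero]
  congr 3
  ring

theorem jacobiCoeff_lower {n j : ℕ} (h : j < n) (a b : ℝ) :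
    (j + 1) * jacobiCoeff n a b (j + 1) + (j + b) * jacobiCoeff n a b j
      = (b + n) * jacobiCoeff n (a + 1) (b - 1) j := by
  obtain ⟨p, rfl⟩ := Nat.exists_eq_add_of_lt h
  simp only [jacobiCoeff, show j + p + 1 - (j + 1) = p by omega,
    show j + p + 1 - j = p + 1 by omega, pochhammerSymbol_succ (_ + a + b + 1) j]
  rw [pochhammerSymbol_succ_left (a + j + 1) p, pochhammerSymbol_succ (a + 1 + j + 1) p,
    show a + ((j + 1 : ℕ) : ℝ) + 1 = a + j + 1 + 1 by push_cast; ring,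
    show a + 1 + (j : ℝ) + 1 = a + j + 1 + 1 by ring,
    show ((j + p + 1 : ℕ) : ℝ) + (a + 1) + (b - 1) + 1 = ((j + p + 1 : ℕ) : ℝ) + a + b + 1 by ring,
    Nat.factorial_succ j, Nat.factorial_succ p]
  have hj : (j.factorial : ℝ) ≠ 0 := by positivity
  have hp : (p.factorial : ℝ) ≠ 0 := by positivity
  push_cast
  field_simp
  ring

/-- After multiplication by `(1 - t)^(b-1)` the left side is the derivative of `(1 - t)^b
P_n^{(a,b)}(1 - 2t)`. The relation is checked coefficient by coefficient in powers of `-t`. -/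
theorem jacobiD_lower (n : ℕ) (a b t : ℝ) :
    (1 - t) * jacobiD n a b t - b * jacobiP n a b (1 - 2 * t)
      = -(b + n) * jacobiP n (a + 1) (b - 1) (1 - 2 * t) := by
  rw [jacobiP_eq_sum, jacobiP_eq_sum, jacobiD]
  -- The Euler operator `t ∂_t` multiplies the coefficient of `(-t)^j` by `j`.
  have e1 : ∑ j ∈ Finset.range (n + 1), (j : ℝ) * jacobiCoeff n a b j * (-t) ^ j
      = -t * ∑ j ∈ Finset.range n, ((j : ℝ) + 1) * jacobiCoeff n a b (j + 1) * (-t) ^ j := by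
    rw [Finset.sum_range_succ', Finset.mul_sum]
    simp only [Nat.cast_zero, zero_mul, add_zero]
    refine Finset.sum_congr rfl fun j _ => ?_
    push_cast
    ring
  have e2 : ∑ j ∈ Finset.range n, ((j : ℝ) + 1) * jacobiCoeff n a b (j + 1) * (-t) ^ j
      + ∑ j ∈ Finset.range (n + 1), (j : ℝ) * jacobiCoeff n a b j * (-t) ^ j
      + b * ∑ j ∈ Finset.range (n + 1), jacobiCoeff n a b j * (-t) ^ j
      = (b + n) * ∑ j ∈ Finset.range (n + 1), jacobiCoeff n (a + 1) (b - 1) j * (-t) ^ j := by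
    rw [Finset.sum_range_succ, Finset.sum_range_succ, Finset.sum_range_succ, jacobiCoeff_lower_top]
    have : ∑ j ∈ Finset.range n, ((j : ℝ) + 1) * jacobiCoeff n a b (j + 1) * (-t) ^ j
      + ∑ j ∈ Finset.range n, (j : ℝ) * jacobiCoeff n a b j * (-t) ^ j
      + b * ∑ j ∈ Finset.range n, jacobiCoeff n a b j * (-t) ^ j
      = (b + n) * ∑ j ∈ Finset.range n, jacobiCoeff n (a + 1) (b - 1) j * (-t) ^ j := by
      rw [Finset.mul_sum, Finset.mul_sum, ← Finset.sum_add_distrib, ← Finset.sum_add_distrib]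
      refine Finset.sum_congr rfl fun j hj => ?_
      have := jacobiCoeff_lower (Finset.mem_range.1 hj) a b
      linear_combination (-t) ^ j * this
    linear_combination this
  linear_combination -e2 + e1

theorem jacobiCoeff_raise_zero (n : ℕ) (a b : ℝ) :
    a * jacobiCoeff n a b 0 = (n + 1) * jacobiCoeff (n + 1) (a - 1) (b - 1) 0 := by
  simp only [jacobiCoeff, pochhammerSymbol_zero, Nat.sub_zero]
  rw [pochhammerSymbol_succ_left, Nat.factorial_succ,
    show a - 1 + ((0 : ℕ) : ℝ) + 1 = a by push_cast; ring,
    show a + ((0 : ℕ) : ℝ) + 1 = a + 1 by push_cast; ring]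
  have hn : (n.factorial : ℝ) ≠ 0 := by positivity
  push_cast
  field_simp

theorem jacobiCoeff_raise_top (n : ℕ) (a b : ℝ) :
    (a + b + n) * jacobiCoeff n a b n
      = (n + 1) * jacobiCoeff (n + 1) (a - 1) (b - 1) (n + 1) := by
  simp only [jacobiCoeff, pochhammerSymbol_zero, Nat.sub_self]
  rw [pochhammerSymbol_succ_left, Nat.factorial_succ,
    show ((n + 1 : ℕ) : ℝ) + (a - 1) + (b - 1) + 1 = n + a + b by push_cast; ring]
  have hn : (n.factorial : ℝ) ≠ 0 := by positivity
  push_cast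
  field_simp
  ring

theorem jacobiCoeff_raise {n j : ℕ} (h : j < n) (a b : ℝ) :
    (a + j + 1) * jacobiCoeff n a b (j + 1) + (a + b + j) * jacobiCoeff n a b j
      = (n + 1) * jacobiCoeff (n + 1) (a - 1) (b - 1) (j + 1) := by
  obtain ⟨p, rfl⟩ := Nat.exists_eq_add_of_lt h
  simp only [jacobiCoeff, show j + p + 1 - (j + 1) = p by omega,
    show j + p + 1 - j = p + 1 by omega, show j + p + 1 + 1 - (j + 1) = p + 1 by omega]
  rw [show a - 1 + ((j + 1 : ℕ) : ℝ) + 1 = a + j + 1 by push_cast; ring,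
    pochhammerSymbol_succ_left (a + j + 1) p,
    pochhammerSymbol_succ (_ + a + b + 1) j,
    show ((j + p + 1 + 1 : ℕ) : ℝ) + (a - 1) + (b - 1) + 1 = ((j + p + 1 : ℕ) : ℝ) + a + b by
      push_cast; ring,
    pochhammerSymbol_succ_left (_ + a + b) j,
    show a + ((j + 1 : ℕ) : ℝ) + 1 = a + j + 1 + 1 by push_cast; ring,
    Nat.factorial_succ j, Nat.factorial_succ p]
  have hj : (j.factorial : ℝ) ≠ 0 := by positivity
  have hp : (p.factorial : ℝ) ≠ 0 := by positivity
  push_cast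
  field_simp
  ring

/-- This is the Rodrigues step: up to the factor `t^(a-1) (1 - t)^(b-1)`, the left side is the
derivative of `t^a (1 - t)^b P_n^{(a,b)}(1 - 2t)`. At `a = 1/2`, `t = r²` the factor `t^a` becomes
`r`. -/
theorem jacobiD_raise (n : ℕ) (a b t : ℝ) :
    (a * (1 - t) - b * t) * jacobiP n a b (1 - 2 * t) + t * (1 - t) * jacobiD n a b t
      = (n + 1) * jacobiP (n + 1) (a - 1) (b - 1) (1 - 2 * t) := by
  rw [jacobiP_eq_sum, jacobiP_eq_sum, jacobiD]
  have e1 : ∑ j ∈ Finset.range (n + 1), (j : ℝ) * jacobiCoeff n a b j * (-t) ^ j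
      = -t * ∑ j ∈ Finset.range n, ((j : ℝ) + 1) * jacobiCoeff n a b (j + 1) * (-t) ^ j := by
    rw [Finset.sum_range_succ', Finset.mul_sum]
    simp only [Nat.cast_zero, zero_mul, add_zero]
    refine Finset.sum_congr rfl fun j _ => ?_
    push_cast
    ring
  have e2 : ∑ j ∈ Finset.range (n + 1), (a + j) * jacobiCoeff n a b j * (-t) ^ j
      + ∑ j ∈ Finset.range (n + 1), (a + b + j) * jacobiCoeff n a b j * (-t) ^ (j + 1)
      = (n + 1) * ∑ j ∈ Finset.range (n + 1 + 1),
          jacobiCoeff (n + 1) (a - 1) (b - 1) j * (-t) ^ j := by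
    rw [Finset.sum_range_succ', Finset.sum_range_succ (fun j : ℕ => (a + b + j) * _ * _),
      Finset.sum_range_succ', Finset.sum_range_succ]
    have : ∑ j ∈ Finset.range n, (a + ((j + 1 : ℕ) : ℝ)) * jacobiCoeff n a b (j + 1) * (-t) ^ (j + 1)
      + ∑ j ∈ Finset.range n, (a + b + j) * jacobiCoeff n a b j * (-t) ^ (j + 1)
      = (n + 1) * ∑ j ∈ Finset.range n,
          jacobiCoeff (n + 1) (a - 1) (b - 1) (j + 1) * (-t) ^ (j + 1) := by
      rw [Finset.mul_sum, ← Finset.sum_add_distrib]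
      refine Finset.sum_congr rfl fun j hj => ?_
      have := jacobiCoeff_raise (Finset.mem_range.1 hj) a b
      push_cast
      linear_combination (-t) ^ (j + 1) * this
    have h0 := jacobiCoeff_raise_zero n a b
    have h1 := jacobiCoeff_raise_top n a b
    simp only [Nat.cast_zero, pow_zero]
    linear_combination this + h0 + (-t) ^ (n + 1) * h1
  have e3 : ∑ j ∈ Finset.range (n + 1), (a + j) * jacobiCoeff n a b j * (-t) ^ j
      = a * ∑ j ∈ Finset.range (n + 1), jacobiCoeff n a b j * (-t) ^ j
        + ∑ j ∈ Finset.range (n + 1), (j : ℝ) * jacobiCoeff n a b j * (-t) ^ j := by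
    rw [Finset.mul_sum, ← Finset.sum_add_distrib]
    exact Finset.sum_congr rfl fun j _ => by ring
  have e4 : ∑ j ∈ Finset.range (n + 1), (a + b + j) * jacobiCoeff n a b j * (-t) ^ (j + 1)
      = -t * ((a + b) * ∑ j ∈ Finset.range (n + 1), jacobiCoeff n a b j * (-t) ^ j
        + ∑ j ∈ Finset.range (n + 1), (j : ℝ) * jacobiCoeff n a b j * (-t) ^ j) := by
    rw [Finset.mul_sum, ← Finset.sum_add_distrib, Finset.mul_sum]
    exact Finset.sum_congr rfl fun j _ => by ring
  linear_combination e2 - e3 - e4 - (1 - t) * e1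

/-! ### Derivatives of weighted Jacobi polynomials in `r`. -/

/-- `(1 - r²)^b P_n^{(a,b)}(1 - 2r²)`. -/
noncomputable def jacobiFun (n : ℕ) (a b r : ℝ) : ℝ :=
  (1 - r ^ 2) ^ b * jacobiP n a b (1 - 2 * r ^ 2)

theorem one_sub_sq_pos {r : ℝ} (h : r ∈ Set.Ioo (0 : ℝ) 1) : 0 < 1 - r ^ 2 := by
  nlinarith [h.1, h.2]

theorem hasDerivAt_jacobiFun_aux (n : ℕ) (a b : ℝ) {r : ℝ} (h : r ∈ Set.Ioo (0 : ℝ) 1) :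
    HasDerivAt (jacobiFun n a b)
      (2 * r * (1 - r ^ 2) ^ (b - 1) *
        ((1 - r ^ 2) * jacobiD n a b (r ^ 2) - b * jacobiP n a b (1 - 2 * r ^ 2))) r := by
  have hp := one_sub_sq_pos h
  have hsq : HasDerivAt (fun r : ℝ => r ^ 2) (2 * r) r := by
    simpa using hasDerivAt_pow 2 r
  have h1 := (hsq.const_sub 1).rpow_const (p := b) (Or.inl hp.ne')
  have h2 : HasDerivAt (fun r : ℝ => jacobiP n a b (1 - 2 * r ^ 2))
      (jacobiD n a b (r ^ 2) * (2 * r)) r :=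
    HasDerivAt.comp (h₂ := fun t => jacobiP n a b (1 - 2 * t)) r
      (hasDerivAt_jacobiP n a b (r ^ 2)) hsq
  refine (h1.mul h2).congr_deriv ?_
  have : (1 - r ^ 2) ^ b = (1 - r ^ 2) ^ (b - 1) * (1 - r ^ 2) := by
    rw [← Real.rpow_add_one hp.ne', sub_add_cancel]
  rw [this]
  ring

theorem hasDerivAt_jacobiFun (n : ℕ) (a b : ℝ) {r : ℝ} (h : r ∈ Set.Ioo (0 : ℝ) 1) :
    HasDerivAt (jacobiFun n a b) (-2 * (b + n) * r * jacobiFun n (a + 1) (b - 1) r) r := by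
  refine (hasDerivAt_jacobiFun_aux n a b h).congr_deriv ?_
  rw [jacobiD_lower, jacobiFun]
  ring

theorem hasDerivAt_mul_jacobiFun (n : ℕ) (b : ℝ) {r : ℝ} (h : r ∈ Set.Ioo (0 : ℝ) 1) :
    HasDerivAt (fun r => r * jacobiFun n (1 / 2) b r)
      (2 * (n + 1) * jacobiFun (n + 1) (-1 / 2) (b - 1) r) r := by
  have hp := one_sub_sq_pos h
  refine ((hasDerivAt_id r).mul (hasDerivAt_jacobiFun_aux n (1 / 2) b h)).congr_deriv ?_
  have h1 := jacobiD_raise n (1 / 2) b (r ^ 2)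
  have : (1 - r ^ 2) ^ b = (1 - r ^ 2) ^ (b - 1) * (1 - r ^ 2) := by
    rw [← Real.rpow_add_one hp.ne', sub_add_cancel]
  rw [show (1 / 2 : ℝ) - 1 = -1 / 2 by norm_num] at h1
  simp only [jacobiFun, id]
  rw [this]
  linear_combination 2 * (1 - r ^ 2) ^ (b - 1) * h1

/-- Differentiates an identity valid on all of `(0, 1)`; every induction on the order of
differentiation advances by it. -/
theorem ofReal_deriv_eq {f : ℝ → ℂ} {g : ℝ → ℝ} {f' : ℂ} {g' r : ℝ}
    (hr : r ∈ Set.Ioo (0 : ℝ) 1) (h : ∀ s ∈ Set.Ioo (0 : ℝ) 1, f s = g s)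
    (hf : HasDerivAt f f' r) (hg : HasDerivAt g g' r) : f' = g' :=
  hf.unique (hg.ofReal_comp.congr_of_eventuallyEq
    (Filter.eventually_of_mem (Ioo_mem_nhds hr.1 hr.2) h))

/-! ### The operator `(r⁻¹ ∂_r)^K r⁻¹`. -/

/-- The coefficients `(2K-n)! / ((2K-2n)!! n!)` of the operator `(r⁻¹ ∂_r)^K r⁻¹`,
by recursion on `K`. -/
def besselCoeff : ℕ → ℕ → ℕ
  | 0, 0 => 1
  | 0, _ + 1 => 0
  | K + 1, 0 => (2 * K + 1) * besselCoeff K 0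
  | K + 1, n + 1 => besselCoeff K n + (2 * K - n) * besselCoeff K (n + 1)

theorem besselCoeff_eq_zero {K n : ℕ} (h : K < n) : besselCoeff K n = 0 := by
  induction K generalizing n with
  | zero => obtain ⟨n, rfl⟩ := Nat.exists_eq_succ_of_ne_zero h.ne'; rfl
  | succ K ih =>
    obtain ⟨n, rfl⟩ := Nat.exists_eq_succ_of_ne_zero (Nat.ne_zero_of_lt h)
    rw [besselCoeff, ih (by omega), ih (by omega), mul_zero, add_zero]

/-- The closed form, with `K = n + j` and denominators cleared so that the induction stays free of
subtraction and division. -/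
theorem besselCoeff_mul (n j : ℕ) :
    besselCoeff (n + j) n * (2 ^ j * j.factorial * n.factorial) = (n + 2 * j).factorial := by
  induction h : n + j generalizing n j with
  | zero =>
    obtain ⟨rfl, rfl⟩ : n = 0 ∧ j = 0 := by omega
    rfl
  | succ K ih =>
    cases n with
    | zero =>
      obtain rfl : j = K + 1 := by omega
      have := ih 0 K (by omega)
      rw [besselCoeff, pow_succ, Nat.factorial_succ K,
        show 0 + 2 * (K + 1) = 0 + 2 * K + 1 + 1 by ring, Nat.factorial_succ, Nat.factorial_succ,
        ← this]
      ring
    | succ n =>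
      have h1 := ih n j (by omega)
      cases j with
      | zero =>
        rw [besselCoeff, besselCoeff_eq_zero (K := K) (n := n + 1) (by omega), mul_zero, add_zero]
        simp only [mul_zero, add_zero] at h1 ⊢
        rw [Nat.factorial_succ n]
        linear_combination (n + 1) * h1
      | succ j =>
        have h2 := ih (n + 1) j (by omega)
        rw [besselCoeff, show 2 * K - n = n + 2 * j + 2 by omega]
        rw [show n + 1 + 2 * (j + 1) = (n + 2 * (j + 1)) + 1 by ring,
          Nat.factorial_succ (n + 2 * (j + 1)), ← h1]
        have h3 : (n + 2 * (j + 1)).factorial = (n + 2 * j + 2) * (n + 1 + 2 * j).factorial := by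
          rw [show n + 2 * (j + 1) = (n + 1 + 2 * j) + 1 by ring, Nat.factorial_succ]
          ring
        rw [← h2, ← h1] at h3
        rw [Nat.factorial_succ n] at *
        simp only [pow_succ, Nat.factorial_succ j] at *
        linear_combination (2 * (j + 1)) * h3.symm

/-- `(r⁻¹ ∂_r)^K (r⁻¹ y₀)` where `y (n+1)` is the derivative of `y n`. -/
noncomputable def besselSum (K : ℕ) (y : ℕ → ℝ → ℂ) (r : ℝ) : ℂ :=
  ∑ n ∈ Finset.range (K + 1),
    (-1) ^ (K + n) * besselCoeff K n * (y n r / (r : ℂ) ^ (2 * K + 1 - n))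

theorem hasDerivAt_div_ofReal_pow {f : ℝ → ℂ} {f' : ℂ} {r : ℝ} (hr : r ≠ 0)
    (hf : HasDerivAt f f' r) (e : ℕ) :
    HasDerivAt (fun s => f s / (s : ℂ) ^ (e + 1))
      (r * (f' / (r : ℂ) ^ (e + 2) - (e + 1) * (f r / (r : ℂ) ^ (e + 3)))) r := by
  have hr' : (r : ℂ) ≠ 0 := by exact_mod_cast hr
  have h1 : HasDerivAt (fun s : ℝ => (s : ℂ) ^ (e + 1)) ((e + 1 : ℕ) * (r : ℂ) ^ e) r := by
    simpa using (hasDerivAt_pow (e + 1) (r : ℂ)).comp_ofReal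
  refine (hf.div h1 (pow_ne_zero _ hr')).congr_deriv ?_
  push_cast
  simp only [pow_succ]
  field_simp

/-- Differentiating `y n / r^(2K+1-n)` either raises `n` or brings down the factor `-(2K+1-n)`;
collecting the two contributions to each derivative of `y 0` is the recursion of `besselCoeff`. -/
theorem hasDerivAt_besselSum {y : ℕ → ℝ → ℂ} {r : ℝ} (hr : r ≠ 0)
    (hy : ∀ n, HasDerivAt (y n) (y (n + 1) r) r) (K : ℕ) :
    HasDerivAt (besselSum K y) (r * besselSum (K + 1) y r) r := by
  have h : ∀ n ∈ Finset.range (K + 1), HasDerivAt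
      (fun s => (-1 : ℂ) ^ (K + n) * besselCoeff K n * (y n s / (s : ℂ) ^ (2 * K + 1 - n)))
      ((-1 : ℂ) ^ (K + n) * besselCoeff K n * (r * (y (n + 1) r / (r : ℂ) ^ (2 * K + 2 - n)
        - ((2 * K - n : ℕ) + 1) * (y n r / (r : ℂ) ^ (2 * K + 3 - n))))) r := fun n hn => by
    have hn' := Finset.mem_range.1 hn
    have := (hasDerivAt_div_ofReal_pow hr (hy n) (2 * K - n)).const_mul
      ((-1 : ℂ) ^ (K + n) * besselCoeff K n)
    rwa [show 2 * K - n + 1 = 2 * K + 1 - n by omega, show 2 * K - n + 2 = 2 * K + 2 - n by omega,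
      show 2 * K - n + 3 = 2 * K + 3 - n by omega] at this
  refine (HasDerivAt.fun_sum h).congr_deriv ?_
  have e1 : ∑ n ∈ Finset.range (K + 1), (-1 : ℂ) ^ (K + n) * besselCoeff K n *
        (((2 * K - n : ℕ) + 1) * (y n r / (r : ℂ) ^ (2 * K + 3 - n)))
      = ∑ n ∈ Finset.range (K + 1), (-1 : ℂ) ^ (K + (n + 1)) * besselCoeff K (n + 1) *
        ((2 * K - n : ℕ) * (y (n + 1) r / (r : ℂ) ^ (2 * K + 2 - n)))
        + (-1 : ℂ) ^ K * besselCoeff K 0 * ((2 * K + 1) * (y 0 r / (r : ℂ) ^ (2 * K + 3))) := by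
    -- The shift of index leaves two boundary terms: `n = 0` gives the factor `2K + 1`, and the top
    -- one vanishes because `besselCoeff K (K + 1) = 0`.
    rw [Finset.sum_range_succ', Finset.sum_range_succ, besselCoeff_eq_zero (lt_add_one K)]
    simp only [Nat.cast_zero, mul_zero, zero_mul, add_zero, Nat.sub_zero]
    push_cast
    congr 1
    refine Finset.sum_congr rfl fun n hn => ?_
    have hn' := Finset.mem_range.1 hn
    rw [show 2 * K - n = 2 * K - (n + 1) + 1 by omega]
    push_cast
    rfl
  have e2 : ∑ n ∈ Finset.range (K + 1), (-1 : ℂ) ^ (K + 1 + (n + 1)) * besselCoeff (K + 1) (n + 1) *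
        (y (n + 1) r / (r : ℂ) ^ (2 * (K + 1) + 1 - (n + 1)))
      = ∑ n ∈ Finset.range (K + 1), (-1 : ℂ) ^ (K + n) * besselCoeff K n *
          (y (n + 1) r / (r : ℂ) ^ (2 * K + 2 - n))
        - ∑ n ∈ Finset.range (K + 1), (-1 : ℂ) ^ (K + (n + 1)) * besselCoeff K (n + 1) *
        ((2 * K - n : ℕ) * (y (n + 1) r / (r : ℂ) ^ (2 * K + 2 - n))) := by
    rw [← Finset.sum_sub_distrib]
    refine Finset.sum_congr rfl fun n _ => ?_
    rw [show 2 * (K + 1) + 1 - (n + 1) = 2 * K + 2 - n by omega, besselCoeff]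
    push_cast
    ring
  have e3 : ∑ n ∈ Finset.range (K + 1), (-1 : ℂ) ^ (K + n) * besselCoeff K n *
        (r * (y (n + 1) r / (r : ℂ) ^ (2 * K + 2 - n)
        - ((2 * K - n : ℕ) + 1) * (y n r / (r : ℂ) ^ (2 * K + 3 - n))))
      = r * (∑ n ∈ Finset.range (K + 1), (-1 : ℂ) ^ (K + n) * besselCoeff K n *
          (y (n + 1) r / (r : ℂ) ^ (2 * K + 2 - n))
        - ∑ n ∈ Finset.range (K + 1), (-1 : ℂ) ^ (K + n) * besselCoeff K n *
        (((2 * K - n : ℕ) + 1) * (y n r / (r : ℂ) ^ (2 * K + 3 - n)))) := by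
    rw [← Finset.sum_sub_distrib, Finset.mul_sum]
    exact Finset.sum_congr rfl fun n _ => by ring
  rw [besselSum, Finset.sum_range_succ' _ (K + 1), e3, e2, e1, show 2 * (K + 1) + 1 - 0 = 2 * K + 3 by omega, besselCoeff]
  push_cast
  ring

/-- The initial `r⁻¹` removes the factor `r`. Each later derivative produces `-2 (b - K + l) r`,
whose `r` is cancelled by the next `r⁻¹`; the constants accumulate to the Pochhammer symbol. -/
theorem besselSum_eq_jacobiFun {y : ℕ → ℝ → ℂ}
    (hy : ∀ r ∈ Set.Ioo (0 : ℝ) 1, ∀ n, HasDerivAt (y n) (y (n + 1) r) r) {c a b : ℝ} {l : ℕ}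
    (h0 : ∀ r ∈ Set.Ioo (0 : ℝ) 1, y 0 r = ((c * (r * jacobiFun l a b r) : ℝ) : ℂ)) (K : ℕ) :
    ∀ r ∈ Set.Ioo (0 : ℝ) 1, besselSum K y r
      = ((c * ((-2) ^ K * pochhammerSymbol (b + l - K + 1) K) * jacobiFun l (a + K) (b - K) r : ℝ)
        : ℂ) := by
  induction K with
  | zero =>
    intro r hr
    have hr' : (r : ℂ) ≠ 0 := by exact_mod_cast hr.1.ne'
    simp [besselSum, h0 r hr, besselCoeff, pochhammerSymbol_zero]
    field_simp
  | succ K ih =>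
    intro r hr
    have hr' : (r : ℂ) ≠ 0 := by exact_mod_cast hr.1.ne'
    have h := ofReal_deriv_eq hr ih (hasDerivAt_besselSum hr.1.ne' (hy r hr) K)
      ((hasDerivAt_jacobiFun l (a + K) (b - K) hr).const_mul _)
    apply mul_left_cancel₀ hr'
    rw [h, pochhammerSymbol_succ_left, show b + l - ((K + 1 : ℕ) : ℝ) + 1 + 1 = b + l - K + 1 by
      push_cast; ring, show a + ((K + 1 : ℕ) : ℝ) = a + K + 1 by push_cast; ring,
      show b - ((K + 1 : ℕ) : ℝ) = b - K - 1 by push_cast; ring]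
    push_cast
    ring

/-! ### Derivatives of `(1 + z²)^β` and of `(1 - r²)^β`. -/

theorem hasDerivAt_powQ (β : ℝ) (n : ℕ) {z : ℂ} (hz : 1 + z ^ 2 ∈ Complex.slitPlane) :
    HasDerivAt (powQ β n) (powQ β (n + 1) z) z := by
  have h1 : HasDerivAt (fun z : ℂ => 1 + z ^ 2) (2 * z) z := by
    simpa using (hasDerivAt_pow 2 z).const_add 1
  have h2 := (h1.cpow_const (c := ((β - n : ℝ) : ℂ)) hz).mul ((polyQ β n).hasDerivAt_aeval z)
  refine h2.congr_deriv ?_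
  have hne := Complex.slitPlane_ne_zero hz
  have e : (1 + z ^ 2) ^ ((β - n : ℝ) : ℂ)
      = (1 + z ^ 2) ^ (((β - n : ℝ) : ℂ) - 1) * (1 + z ^ 2) := by
    nth_rewrite 3 [← Complex.cpow_one (1 + z ^ 2)]
    rw [← Complex.cpow_add _ _ hne, sub_add_cancel]
  rw [powQ, polyQ, e, show ((β - (n + 1 : ℕ) : ℝ) : ℂ) = ((β - n : ℝ) : ℂ) - 1 by push_cast; ring]
  simp
  ring

theorem polyQ_comp_neg (β : ℝ) (n : ℕ) :
    (polyQ β n).comp (-Polynomial.X) = (-1) ^ n * polyQ β n := by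
  induction n with
  | zero => simp [polyQ]
  | succ n ih =>
    have h := congrArg Polynomial.derivative ih
    have hc : ((-1 : Polynomial ℝ) ^ n) = Polynomial.C ((-1) ^ n) := by simp
    rw [Polynomial.derivative_comp, hc, Polynomial.derivative_C_mul, ← hc] at h
    simp only [Polynomial.derivative_neg, Polynomial.derivative_X] at h
    simp only [polyQ, Polynomial.add_comp, Polynomial.mul_comp, Polynomial.C_comp,
      Polynomial.X_comp, Polynomial.pow_comp, Polynomial.one_comp, ih]
    linear_combination -(1 + Polynomial.X ^ 2) * h

theorem powQ_neg (β : ℝ) (n : ℕ) (z : ℂ) : powQ β n (-z) = (-1) ^ n * powQ β n z := by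
  have h := congrArg (Polynomial.aeval z) (polyQ_comp_neg β n)
  simp only [Polynomial.aeval_comp, map_neg, Polynomial.aeval_X, map_mul, map_pow, map_one] at h
  rw [powQ, powQ, h, neg_sq]
  ring

/-- The `n`-th derivative of `r ↦ (1 - r²)^β`. -/
noncomputable def radialDeriv (β : ℝ) (n : ℕ) (r : ℝ) : ℂ :=
  Complex.I ^ n * powQ β n (r * Complex.I)

/-- If `1 + w²` were real and nonpositive, `w` would be purely imaginary with modulus at least `1`,
but the disc lies in `|Im w| < 1`. -/
theorem one_add_sq_mem_slitPlane {r : ℝ} (h : r ∈ Set.Ioo (0 : ℝ) 1) {w : ℂ}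
    (hw : ‖w - r * Complex.I‖ < 1 - r) : 1 + w ^ 2 ∈ Complex.slitPlane := by
  rw [Complex.mem_slitPlane_iff]
  by_contra hcon
  push Not at hcon
  obtain ⟨h1, h2⟩ := hcon
  have him : |w.im - r| < 1 - r := by
    have := (Complex.abs_im_le_norm (w - r * Complex.I)).trans_lt hw
    simpa using this
  rw [abs_lt] at him
  simp [pow_two] at h1 h2
  have h3 : w.re * w.im = 0 := by linarith
  have h4 : w.im ^ 2 < 1 := by nlinarith [h.1, h.2]
  rcases mul_eq_zero.1 h3 with h5 | h5
  · rw [h5] at h1; nlinarith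
  · rw [h5] at h1; nlinarith

theorem hasDerivAt_radialDeriv (β : ℝ) (n : ℕ) {r : ℝ} (h : r ∈ Set.Ioo (0 : ℝ) 1) :
    HasDerivAt (radialDeriv β n) (radialDeriv β (n + 1) r) r := by
  have h1 : HasDerivAt (fun z : ℂ => Complex.I ^ n * powQ β n (z * Complex.I))
      (radialDeriv β (n + 1) r) (r : ℂ) := by
    have hz : 1 + ((r : ℂ) * Complex.I) ^ 2 ∈ Complex.slitPlane :=
      one_add_sq_mem_slitPlane h (by simpa using h.2)
    have h2 : HasDerivAt (fun z : ℂ => z * Complex.I) Complex.I (r : ℂ) := by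
      simpa using (hasDerivAt_id (r : ℂ)).mul_const Complex.I
    refine (((hasDerivAt_powQ β n hz).comp (r : ℂ) h2).const_mul (Complex.I ^ n)).congr_deriv ?_
    rw [radialDeriv]
    ring
  exact h1.comp_ofReal

/-- The induction alternates the two relations: `jacobiD_lower` leads from order `2l` to `2l + 1`,
turning the parameter `-1/2` into `1/2`, and the Rodrigues step leads from `2l + 1` to `2l + 2`,
turning it back and raising the degree. -/
theorem radialDeriv_even_odd (β : ℝ) (l : ℕ) :
    (∀ r ∈ Set.Ioo (0 : ℝ) 1, radialDeriv β (2 * l) r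
      = (((-1) ^ l * 2 ^ (2 * l) * l.factorial * pochhammerSymbol (β - l + 1) l
        * jacobiFun l (-1 / 2) (β - 2 * l) r : ℝ) : ℂ)) ∧
    (∀ r ∈ Set.Ioo (0 : ℝ) 1, radialDeriv β (2 * l + 1) r
      = (((-1) ^ (l + 1) * 2 ^ (2 * l + 1) * l.factorial * pochhammerSymbol (β - l) (l + 1)
        * (r * jacobiFun l (1 / 2) (β - 2 * l - 1) r) : ℝ) : ℂ)) := by
  have step : ∀ l : ℕ, (∀ r ∈ Set.Ioo (0 : ℝ) 1, radialDeriv β (2 * l) r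
      = (((-1) ^ l * 2 ^ (2 * l) * l.factorial * pochhammerSymbol (β - l + 1) l
        * jacobiFun l (-1 / 2) (β - 2 * l) r : ℝ) : ℂ)) →
      (∀ r ∈ Set.Ioo (0 : ℝ) 1, radialDeriv β (2 * l + 1) r
      = (((-1) ^ (l + 1) * 2 ^ (2 * l + 1) * l.factorial * pochhammerSymbol (β - l) (l + 1)
        * (r * jacobiFun l (1 / 2) (β - 2 * l - 1) r) : ℝ) : ℂ)) := by
    intro l hl r hr
    rw [ofReal_deriv_eq hr hl (hasDerivAt_radialDeriv β (2 * l) hr)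
      ((hasDerivAt_jacobiFun l (-1 / 2) (β - 2 * l) hr).const_mul _),
      pochhammerSymbol_succ_left, show (-1 / 2 : ℝ) + 1 = 1 / 2 by norm_num]
    congr 1
    ring
  induction l with
  | zero =>
    refine ⟨?_, step 0 ?_⟩ <;>
    · intro r hr
      have h := one_sub_sq_pos hr
      simp [radialDeriv, powQ, polyQ, jacobiFun, jacobiP_zero, pochhammerSymbol_zero]
      rw [mul_pow, Complex.I_sq, Complex.ofReal_cpow h.le]
      push_cast
      ring_nf
  | succ l ih =>
    have : ∀ r ∈ Set.Ioo (0 : ℝ) 1, radialDeriv β (2 * (l + 1)) r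
      = (((-1) ^ (l + 1) * 2 ^ (2 * (l + 1)) * (l + 1).factorial
        * pochhammerSymbol (β - (l + 1 : ℕ) + 1) (l + 1)
        * jacobiFun (l + 1) (-1 / 2) (β - 2 * (l + 1 : ℕ)) r : ℝ) : ℂ) := by
      intro r hr
      rw [show 2 * (l + 1) = 2 * l + 1 + 1 by ring, ofReal_deriv_eq hr ih.2
        (hasDerivAt_radialDeriv β (2 * l + 1) hr)
        ((hasDerivAt_mul_jacobiFun l (β - 2 * l - 1) hr).const_mul _), Nat.factorial_succ,
        show β - ((l + 1 : ℕ) : ℝ) + 1 = β - l by push_cast; ring,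
        show β - 2 * ((l + 1 : ℕ) : ℝ) = β - 2 * l - 1 - 1 by push_cast; ring]
      congr 1
      push_cast
      ring
    exact ⟨this, step _ this⟩

theorem besselSum_radialDeriv (β : ℝ) (l K : ℕ) {r : ℝ} (hr : r ∈ Set.Ioo (0 : ℝ) 1) :
    besselSum K (fun n => radialDeriv β (2 * l + 1 + n)) r
      = (((-1) ^ (K + l + 1) * 2 ^ (2 * l + 1 + K) * l.factorial
        * pochhammerSymbol (β - l - K) (l + 1 + K)
        * jacobiFun l (K + 1 / 2) (β - 2 * l - 1 - K) r : ℝ) : ℂ) := by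
  rw [besselSum_eq_jacobiFun (fun r hr n => hasDerivAt_radialDeriv β (2 * l + 1 + n) hr)
    (radialDeriv_even_odd β l).2 K r hr, add_comm (l + 1) K,
    pochhammerSymbol_add (β - l - K) K (l + 1), show β - l - K + K = β - l by ring, show β - 2 * l - 1 + l - K + 1 = β - l - K by ring,
    add_comm (1 / 2 : ℝ)]
  congr 1
  rw [show (-2 : ℝ) = -1 * 2 by norm_num, mul_pow]
  ring

/-! ### Taylor expansion about `ir`. -/

theorem iteratedDeriv_powQ (β : ℝ) (n j : ℕ) {z : ℂ} (hz : 1 + z ^ 2 ∈ Complex.slitPlane) :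
    iteratedDeriv j (powQ β n) z = powQ β (n + j) z := by
  induction j generalizing z with
  | zero => simp
  | succ j ih =>
    rw [iteratedDeriv_succ]
    have hopen : IsOpen {w : ℂ | 1 + w ^ 2 ∈ Complex.slitPlane} :=
      Complex.isOpen_slitPlane.preimage (by fun_prop)
    exact ((hasDerivAt_powQ β (n + j) hz).congr_of_eventuallyEq
      (Filter.eventually_of_mem (hopen.mem_nhds hz) fun w hw => ih hw)).deriv

theorem hasSum_powQ (β : ℝ) (n : ℕ) {r : ℝ} (hr : r ∈ Set.Ioo (0 : ℝ) 1) {x : ℂ}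
    (hx : ‖x‖ < 1 - r) :
    HasSum (fun j : ℕ => x ^ j / j.factorial * powQ β (n + j) (r * Complex.I))
      (powQ β n (x + r * Complex.I)) := by
  have hd : DifferentiableOn ℂ (powQ β n) (Metric.ball (r * Complex.I) (1 - r)) := fun w hw =>
    (hasDerivAt_powQ β n (one_add_sq_mem_slitPlane hr
      (mem_ball_iff_norm.1 hw))).differentiableAt.differentiableWithinAt
  have h := Complex.hasSum_taylorSeries_on_ball hd (z := x + r * Complex.I)
    (by simpa using hx)
  convert! h using 2 with j
  rw [iteratedDeriv_powQ β n j (one_add_sq_mem_slitPlane hr (by simpa using hr.2))]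
  simp
  ring

theorem hasSum_powQ_star (β : ℝ) (n : ℕ) {r : ℝ} (hr : r ∈ Set.Ioo (0 : ℝ) 1) {x : ℝ}
    (hx : |x| < 1 - r) :
    HasSum (fun j : ℕ => (-1) ^ (n + j) * ((x : ℂ) ^ j / j.factorial)
      * powQ β (n + j) (r * Complex.I)) (powQ β n (star (⟨x, r⟩ : ℂ))) := by
  have e : star (⟨x, r⟩ : ℂ) = -(((-x : ℝ) : ℂ) + r * Complex.I) := by
    apply Complex.ext <;> simp
  have h := (hasSum_powQ β n hr (x := ((-x : ℝ) : ℂ))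
    (by simpa using hx)).mul_left ((-1) ^ n)
  rw [e, powQ_neg]
  convert! h using 2 with j
  push_cast
  rw [neg_pow (x : ℂ)]
  ring

/-- The `j`-th Taylor terms of the two summands combine with weight `1 + (-1)^j`. -/
theorem hasSum_powQ_add_even (β : ℝ) (ν : ℕ) {r x : ℝ} (hr : r ∈ Set.Ioo (0 : ℝ) 1)
    (hx : |x| < 1 - r) :
    HasSum (fun l : ℕ => 2 * ((x : ℂ) ^ (2 * l) / (2 * l).factorial)
        * powQ β (2 * l + 1 + ν) (r * Complex.I))
      (powQ β (ν + 1) (⟨x, r⟩ : ℂ) + (-1) ^ (ν + 1) * powQ β (ν + 1) (star (⟨x, r⟩ : ℂ))) := by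
  have e : (⟨x, r⟩ : ℂ) = x + r * Complex.I := Complex.mk_eq_add_mul_I x r
  have h := (hasSum_powQ β (ν + 1) hr (x := (x : ℂ)) (by simpa using hx)).add
    ((hasSum_powQ_star β (ν + 1) hr hx).mul_left ((-1) ^ (ν + 1)))
  rw [← e] at h
  rw [← (show Function.Injective fun l : ℕ => 2 * l from
    fun a b hab => Nat.eq_of_mul_eq_mul_left two_pos hab).hasSum_iff] at h
  · convert! h using 2 with l
    have h1 : ((-1 : ℂ) ^ (ν + 1)) * (-1) ^ (ν + 1 + 2 * l) = 1 := by
      rw [← pow_add]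
      exact Even.neg_one_pow ⟨ν + 1 + l, by ring⟩
    simp only [Function.comp]
    rw [show 2 * l + 1 + ν = ν + 1 + 2 * l by ring]
    linear_combination -((x : ℂ) ^ (2 * l) / (2 * l).factorial) *
      powQ β (ν + 1 + 2 * l) (r * Complex.I) * h1
  · intro j hj
    have hj' : Odd j := by
      rw [← Nat.not_even_iff_odd]
      rintro ⟨l, rfl⟩
      exact hj ⟨l, by simp; ring⟩
    have h1 : ((-1 : ℂ) ^ (ν + 1)) * (-1) ^ (ν + 1 + j) = -1 := by
      rw [← pow_add, ← add_assoc]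
      exact Odd.neg_one_pow (Even.add_odd ⟨ν + 1, rfl⟩ hj')
    linear_combination ((x : ℂ) ^ j / j.factorial) * powQ β (ν + 1 + j) (r * Complex.I) * h1

/-- Here the weight is `1 - (-1)^j`. The surviving derivatives have the same orders `2l + 1 + ν` as
in the even case, where the shift comes from `ν + 1` instead. -/
theorem hasSum_powQ_add_odd (β : ℝ) (ν : ℕ) {r x : ℝ} (hr : r ∈ Set.Ioo (0 : ℝ) 1)
    (hx : |x| < 1 - r) :
    HasSum (fun l : ℕ => 2 * ((x : ℂ) ^ (2 * l + 1) / (2 * l + 1).factorial)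
        * powQ β (2 * l + 1 + ν) (r * Complex.I))
      (powQ β ν (⟨x, r⟩ : ℂ) + (-1) ^ (ν + 1) * powQ β ν (star (⟨x, r⟩ : ℂ))) := by
  have e : (⟨x, r⟩ : ℂ) = x + r * Complex.I := Complex.mk_eq_add_mul_I x r
  have h := (hasSum_powQ β ν hr (x := (x : ℂ)) (by simpa using hx)).add
    ((hasSum_powQ_star β ν hr hx).mul_left ((-1) ^ (ν + 1)))
  rw [← e] at h
  rw [← (show Function.Injective fun l : ℕ => 2 * l + 1 from
    fun a b hab => by simpa using hab).hasSum_iff] at h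
  · convert! h using 2 with l
    have h1 : ((-1 : ℂ) ^ (ν + 1)) * (-1) ^ (ν + (2 * l + 1)) = 1 := by
      rw [← pow_add]
      exact Even.neg_one_pow ⟨ν + l + 1, by ring⟩
    simp only [Function.comp]
    rw [show 2 * l + 1 + ν = ν + (2 * l + 1) by ring]
    linear_combination -((x : ℂ) ^ (2 * l + 1) / (2 * l + 1).factorial) *
      powQ β (ν + (2 * l + 1)) (r * Complex.I) * h1
  · intro j hj
    have hj' : Even j := by
      rw [← Nat.not_odd_iff_even]
      rintro ⟨l, rfl⟩
      exact hj ⟨l, rfl⟩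
    have h1 : ((-1 : ℂ) ^ (ν + 1)) * (-1) ^ (ν + j) = -1 := by
      rw [← pow_add, show ν + 1 + (ν + j) = 2 * ν + j + 1 by ring]
      exact Odd.neg_one_pow (Even.add_one (Even.add ⟨ν, two_mul ν⟩ hj'))
    linear_combination ((x : ℂ) ^ j / j.factorial) * powQ β (ν + j) (r * Complex.I) * h1

/-! ### Identification of the coefficients of the two series. -/

theorem coeffB_eq {K n : ℕ} (h : n ≤ K) :
    coeffB n 1 K = (-Complex.I) ^ (n + 1) * besselCoeff K n := by
  obtain ⟨j, rfl⟩ := Nat.exists_eq_add_of_le h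
  have h1 : (besselCoeff (n + j) n : ℂ) * (2 ^ j * j.factorial * n.factorial)
      = (n + 2 * j).factorial := by exact_mod_cast besselCoeff_mul n j
  rw [coeffB, show 2 * (n + j) + 1 - n - 1 = n + 2 * j by omega,
    show 2 * (n + j) + 1 - 2 * n - 1 = 2 * j by omega, Nat.doubleFactorial_two_mul, ← h1]
  have hj : (j.factorial : ℂ) ≠ 0 := by exact_mod_cast j.factorial_ne_zero
  have hn : (n.factorial : ℂ) ≠ 0 := by exact_mod_cast n.factorial_ne_zero
  push_cast
  field_simp

/-- Reduces (i) at `K + 1` to the finite sum that also serves (ii) at `K`. -/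
theorem coeffA_succ {K n : ℕ} (h : n ≤ K) : coeffA (n + 1) 1 (K + 1) = coeffB n 1 K := by
  rw [coeffA, coeffB, show 2 * (K + 1) + 1 - (n + 1) - 2 = 2 * K + 1 - n - 1 by omega,
    show 2 * (K + 1) + 1 - 2 * (n + 1) - 1 = 2 * K + 1 - 2 * n - 1 by omega, Nat.add_sub_cancel]

theorem sum_coeffB_mul_powQ (β : ℝ) (l K : ℕ) {r : ℝ} (hr : r ∈ Set.Ioo (0 : ℝ) 1) :
    ∑ n ∈ Finset.range (K + 1), coeffB n 1 K / (r : ℂ) ^ (2 * K + 1 - n)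
        * powQ β (2 * l + 1 + n) (r * Complex.I)
      = ((2 ^ (2 * l + 1 + K) * l.factorial * pochhammerSymbol (β - l - K) (l + 1 + K)
        * jacobiFun l (K + 1 / 2) (β - 2 * l - 1 - K) r : ℝ) : ℂ) := by
  have h := besselSum_radialDeriv β l K hr
  have e : ∑ n ∈ Finset.range (K + 1), coeffB n 1 K / (r : ℂ) ^ (2 * K + 1 - n)
        * powQ β (2 * l + 1 + n) (r * Complex.I)
      = (-1) ^ (K + l + 1) * besselSum K (fun n => radialDeriv β (2 * l + 1 + n)) r := by
    rw [besselSum, Finset.mul_sum]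
    refine Finset.sum_congr rfl fun n hn => ?_
    rw [coeffB_eq (Nat.lt_succ_iff.1 (Finset.mem_range.1 hn)), radialDeriv]
    -- The phases of `coeffB`, `besselSum` and `radialDeriv` differ by a sign that does not depend
    -- on `n`.
    have h1 : (-Complex.I) ^ (n + 1)
        = (-1) ^ (K + l + 1) * (-1) ^ (K + n) * Complex.I ^ (2 * l + 1 + n) := by
      rw [← pow_add, show K + l + 1 + (K + n) = 2 * K + (n + 1 + l) by ring,
        pow_add (-1 : ℂ) (2 * K), pow_mul, neg_one_sq, one_pow, one_mul, neg_pow Complex.I, pow_add (-1 : ℂ) (n + 1) l,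
        show 2 * l + 1 + n = 2 * l + (n + 1) by ring, pow_add Complex.I (2 * l), pow_mul,
        Complex.I_sq]
      have : ((-1 : ℂ) ^ l) * (-1) ^ l = 1 := by rw [← mul_pow]; simp
      linear_combination -(-1) ^ (n + 1) * Complex.I ^ (n + 1) * this
    rw [h1]
    ring
  rw [e, h]
  have : ((-1 : ℂ) ^ (K + l + 1)) * (-1) ^ (K + l + 1) = 1 := by rw [← mul_pow]; simp
  push_cast
  linear_combination (2 ^ (2 * l + 1 + K) * (l.factorial : ℂ)
    * (pochhammerSymbol (β - l - K) (l + 1 + K) : ℂ)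
    * (jacobiFun l (K + 1 / 2) (β - 2 * l - 1 - K) r : ℂ)) * this

theorem prod_Icc_add_eq_pochhammerSymbol (α : ℝ) (K : ℕ) :
    ∏ n ∈ Finset.Icc 1 K, (α + n) = pochhammerSymbol (α + 1) K := by
  induction K with
  | zero => simp [pochhammerSymbol]
  | succ K ih =>
    rw [Finset.prod_Icc_succ_top (by omega), ih, pochhammerSymbol_succ]
    push_cast
    ring

theorem constM_one (K : ℕ) (α : ℝ) :
    constM 1 K α = 2 ^ (K + 1) * pochhammerSymbol (α + 1) K := by
  rw [constM]
  simp only [Nat.sub_self, Nat.zero_div, add_zero]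
  rw [prod_Icc_add_eq_pochhammerSymbol]

/-- The product in `M` is the tail of a longer Pochhammer symbol: `(α-l+1)_{l+K+1} = (α-l+1)_l
(α+1)_{K+1}`. -/
theorem constM_mul_evenTerm (K l : ℕ) (α x r : ℝ) :
    constM 1 (K + 1) α * evenTerm 1 (K + 1) α x r l
      = 2 * (x ^ (2 * l) / (2 * l).factorial) * (2 ^ (2 * l + 1 + K) * l.factorial
        * pochhammerSymbol (α + (K + 1 : ℕ) - l - K) (l + 1 + K)
        * jacobiFun l (K + 1 / 2) (α + (K + 1 : ℕ) - 2 * l - 1 - K) r) := by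
  rw [constM_one, evenTerm, jacobiFun, show l + 1 + K = l + (K + 1) by ring,
    pochhammerSymbol_add _ l, show α + ((K + 1 : ℕ) : ℝ) - l - K = α - l + 1 by push_cast; ring,
    show α - l + 1 + l = α + 1 by ring,
    show α + ((K + 1 : ℕ) : ℝ) - 2 * l - 1 - K = α - 2 * l by push_cast; ring,
    show ((K + 1 : ℕ) : ℝ) + ((1 : ℕ) : ℝ) / 2 - 1 = K + 1 / 2 by push_cast; ring]
  ring

theorem constM_mul_oddTerm (K l : ℕ) (α x r : ℝ) :
    constM 1 K α * oddTerm 1 K α x r l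
      = 2 * (x ^ (2 * l + 1) / (2 * l + 1).factorial) * (r * (2 ^ (2 * l + 1 + K) * l.factorial
        * pochhammerSymbol (α + K - l - K) (l + 1 + K)
        * jacobiFun l (K + 1 / 2) (α + K - 2 * l - 1 - K) r)) := by
  rw [constM_one, oddTerm, jacobiFun,
    pochhammerSymbol_add _ (l + 1) K, show α + K - l - K = α - l by ring,
    show α - l + ((l + 1 : ℕ) : ℝ) = α + 1 by push_cast; ring,
    show α + K - 2 * l - 1 - K = α - 2 * l - 1 by ring, Nat.cast_one]
  ring

theorem hasSum_constM_mul_evenTerm (K : ℕ) (α : ℝ) {r x : ℝ} (hr : r ∈ Set.Ioo (0 : ℝ) 1)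
    (hx : |x| < 1 - r) :
    HasSum (fun l => ((constM 1 (K + 1) α * evenTerm 1 (K + 1) α x r l : ℝ) : ℂ))
      (scalarSum 1 (K + 1) (α + (K + 1 : ℕ)) x r) := by
  have h := hasSum_sum fun n (_ : n ∈ Finset.range (K + 1)) =>
    (hasSum_powQ_add_even (α + (K + 1 : ℕ)) n hr hx).mul_left
      (coeffB n 1 K / (r : ℂ) ^ (2 * K + 1 - n))
  convert! h using 2 with l
  · rw [constM_mul_evenTerm, Complex.ofReal_mul, ← sum_coeffB_mul_powQ _ l K hr, Finset.mul_sum]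
    refine Finset.sum_congr rfl fun n _ => ?_
    push_cast
    ring
  · rw [scalarSum, Nat.sub_self, Nat.zero_div, add_zero, ← Finset.Ico_succ_right_eq_Icc,
      Finset.sum_Ico_eq_sum_range]
    refine Finset.sum_congr (by simp) fun n hn => ?_
    have hn' : n ≤ K := by simpa [Nat.lt_succ_iff] using hn
    rw [add_comm 1 n, coeffA_succ hn',
      show 2 * (K + 1) + 1 - (n + 1) - 1 = 2 * K + 1 - n by omega]

theorem hasSum_constM_mul_oddTerm (K : ℕ) (α : ℝ) {r x : ℝ} (hr : r ∈ Set.Ioo (0 : ℝ) 1)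
    (hx : |x| < 1 - r) :
    HasSum (fun l => ((constM 1 K α * oddTerm 1 K α x r l : ℝ) : ℂ))
      (omegaSum 1 K (α + K) x r) := by
  -- The powers of `r` in `omegaSum` are one lower than in `besselSum`, hence the extra factor `r`.
  have h := hasSum_sum fun n (_ : n ∈ Finset.range (K + 1)) =>
    (hasSum_powQ_add_odd (α + K) n hr hx).mul_left
      (r * (coeffB n 1 K / (r : ℂ) ^ (2 * K + 1 - n)))
  have hr' : (r : ℂ) ≠ 0 := by exact_mod_cast hr.1.ne'
  convert! h using 2 with l
  · rw [constM_mul_oddTerm, Complex.ofReal_mul, Complex.ofReal_mul r, ← sum_coeffB_mul_powQ _ l K hr,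
      Finset.mul_sum, Finset.mul_sum]
    refine Finset.sum_congr rfl fun n _ => ?_
    push_cast
    ring
  · rw [omegaSum, Nat.sub_self, Nat.zero_div, add_zero, ← Finset.Ico_succ_right_eq_Icc,
      ← Finset.range_eq_Ico]
    refine Finset.sum_congr rfl fun n hn => ?_
    have hn' : n < K + 1 := by simpa using hn
    rw [show 2 * K + 1 - n - 1 = 2 * K - n by omega, show 2 * K + 1 - n = 2 * K - n + 1 by omega,
      pow_succ (r : ℂ)]
    field_simp

/-! ### Convergence of the series. -/

theorem abs_pochhammerSymbol_le {a b : ℝ} {n : ℕ} (h : ∀ i < n, |a + i| ≤ |b + i|) :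
    |pochhammerSymbol a n| ≤ |pochhammerSymbol b n| := by
  rw [pochhammerSymbol, pochhammerSymbol, Finset.abs_prod, Finset.abs_prod]
  exact Finset.prod_le_prod (fun _ _ => abs_nonneg _) fun i hi => h i (Finset.mem_range.1 hi)

theorem pochhammerSymbol_nonneg {a : ℝ} (ha : 0 ≤ a) (n : ℕ) : 0 ≤ pochhammerSymbol a n :=
  Finset.prod_nonneg fun _ _ => by positivity

/-- For the parameter `-J` every factor of the first Pochhammer symbol is nonpositive, so the `j`-th
coefficient has sign `(-1)^j` and all terms in powers of `-t` are nonnegative. Their sum thus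
dominates the absolute values for `α` termwise, without loss from cancellation. -/
theorem abs_jacobiP_le {a α J t : ℝ} (ha : 0 ≤ a) (hJ : 2 * a + |α| ≤ J) (ht : 0 ≤ t) (n : ℕ) :
    |jacobiP n a (α - 2 * n) (1 - 2 * t)| ≤ |jacobiP n a (-J - 2 * n) (1 - 2 * t)| := by
  have hα : 0 ≤ |α| := abs_nonneg α
  rw [jacobiP_eq_sum, jacobiP_eq_sum]
  refine ((Finset.abs_sum_le_sum_abs _ _).trans (Finset.sum_le_sum fun j hj => ?_)).trans
    (le_abs_self _)
  have hj' : j ≤ n := Nat.lt_succ_iff.1 (Finset.mem_range.1 hj)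
  have hneg : ∀ i < j, (n : ℝ) + a + (-J - 2 * n) + 1 + i ≤ 0 := fun i hi => by
    have : (i : ℝ) + 1 ≤ n := by exact_mod_cast (by omega : i + 1 ≤ n)
    linarith
  have h1 : |pochhammerSymbol (n + a + (α - 2 * n) + 1) j|
      ≤ |pochhammerSymbol (n + a + (-J - 2 * n) + 1) j| := by
    refine abs_pochhammerSymbol_le fun i hi => ?_
    have hi' : (i : ℝ) + 1 ≤ n := by exact_mod_cast (by omega : i + 1 ≤ n)
    rw [abs_of_nonpos (hneg i hi), abs_le]
    have := abs_le.1 (le_refl |α|)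
    constructor <;> linarith
  have h2 : |pochhammerSymbol (n + a + (-J - 2 * n) + 1) j|
      = pochhammerSymbol (n + a + (-J - 2 * n) + 1) j * (-1) ^ j := by
    rw [pochhammerSymbol, Finset.abs_prod, ← Finset.card_range j, ← Finset.prod_const,
      Finset.card_range, ← Finset.prod_mul_distrib]
    refine Finset.prod_congr rfl fun i hi => ?_
    rw [abs_of_nonpos (hneg i (Finset.mem_range.1 hi))]
    ring
  have h3 : 0 ≤ pochhammerSymbol (a + j + 1) (n - j) := pochhammerSymbol_nonneg (by positivity) _
  rw [h2] at h1
  rw [jacobiCoeff, jacobiCoeff, abs_mul, abs_div, abs_mul, abs_of_nonneg h3, abs_pow, abs_neg,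
    abs_of_nonneg ht, abs_of_nonneg (by positivity : (0 : ℝ) ≤ j.factorial * (n - j).factorial),
    neg_pow t]
  calc _ ≤ pochhammerSymbol (n + a + (-J - 2 * n) + 1) j * (-1) ^ j
        * pochhammerSymbol (a + j + 1) (n - j) / (j.factorial * (n - j).factorial) * t ^ j := by
        gcongr
    _ = _ := by ring

theorem abs_evenTerm_le (K : ℕ) {α J r : ℝ} (x : ℝ) (hr : r ∈ Set.Ioo (0 : ℝ) 1)
    (hJ : 2 * K + 1 + |α| ≤ J) (n : ℕ) :
    |evenTerm 1 (K + 1) α x r n|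
      ≤ (1 - r ^ 2) ^ (α + J) * |evenTerm 1 (K + 1) (-J) x r n| := by
  have hp := one_sub_sq_pos hr
  have hα : 0 ≤ |α| := abs_nonneg α
  have hK : (0 : ℝ) ≤ K := K.cast_nonneg
  have h1 : |pochhammerSymbol (α - n + 1) n| ≤ |pochhammerSymbol (-J - n + 1) n| := by
    refine abs_pochhammerSymbol_le fun i hi => ?_
    have hi' : (i : ℝ) + 1 ≤ n := by exact_mod_cast hi
    rw [abs_of_nonpos (by linarith : -J - (n : ℝ) + 1 + i ≤ 0), abs_le]
    have := abs_le.1 (le_refl |α|)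
    constructor <;> linarith
  have h2 : (1 - r ^ 2) ^ (α - 2 * n) = (1 - r ^ 2) ^ (α + J) * (1 - r ^ 2) ^ (-J - 2 * n) := by
    rw [← Real.rpow_add hp]
    congr 1
    ring
  have h3 := abs_jacobiP_le (a := K + 1 / 2) (α := α) (J := J) (t := r ^ 2) (by positivity)
    (by linarith) (by positivity) n
  rw [evenTerm, evenTerm, h2,
    show ((K + 1 : ℕ) : ℝ) + ((1 : ℕ) : ℝ) / 2 - 1 = K + 1 / 2 by push_cast; ring]
  simp only [abs_mul, abs_div]
  rw [abs_of_pos (Real.rpow_pos_of_pos hp (α + J))]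
  calc _ ≤ |(2 : ℝ) ^ (2 * n)| * |(n.factorial : ℝ)| * |pochhammerSymbol (-J - n + 1) n|
        * |x ^ (2 * n)| / |((2 * n).factorial : ℝ)|
        * ((1 - r ^ 2) ^ (α + J) * |(1 - r ^ 2) ^ (-J - 2 * n)|)
        * |jacobiP n (K + 1 / 2) (-J - 2 * n) (1 - 2 * r ^ 2)| := by
        gcongr
    _ = _ := by ring

/-- For the parameter `-J` the factor `M` is nonzero and can be cancelled from the convergent Taylor
series; the general case follows by comparison, even where `M` vanishes. -/
theorem summable_evenTerm (K : ℕ) (α : ℝ) {r x : ℝ} (hr : r ∈ Set.Ioo (0 : ℝ) 1)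
    (hx : |x| < 1 - r) : Summable (evenTerm 1 (K + 1) α x r) := by
  -- The comparison needs only `2K + 1 + |α|`; one more unit makes every factor `-J + 1 + i`, `i ≤
  -- K`, of `M` strictly negative.
  set J : ℝ := 2 * K + 2 + |α| with hJ
  have hα : 0 ≤ |α| := abs_nonneg α
  have hM : constM 1 (K + 1) (-J) ≠ 0 := by
    rw [constM_one, pochhammerSymbol]
    refine mul_ne_zero (by positivity) (Finset.prod_ne_zero_iff.2 fun i hi => ?_)
    have hi' : (i : ℝ) + 1 ≤ K + 1 := by exact_mod_cast Finset.mem_range.1 hi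
    have hK : (0 : ℝ) ≤ K := K.cast_nonneg
    exact ne_of_lt (by linarith)
  have h := Complex.summable_ofReal.1 (hasSum_constM_mul_evenTerm K (-J) hr hx).summable
  have h' : Summable (evenTerm 1 (K + 1) (-J) x r) := (summable_mul_left_iff hM).1 h
  exact Summable.of_abs (Summable.of_nonneg_of_le (fun _ => abs_nonneg _)
    (abs_evenTerm_le K x hr (by linarith)) (h'.abs.mul_left _))

/-- Transfers summability from the even series at `α - 1` to the odd one, since `1 / (2n + 1)` is
bounded. -/
theorem oddTerm_eq (K : ℕ) (α x r : ℝ) (n : ℕ) :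
    oddTerm 1 K α x r n
      = 2 * α * x * r / (2 * n + 1) * evenTerm 1 (K + 1) (α - 1) x r n := by
  rw [oddTerm, evenTerm, pochhammerSymbol_succ, Nat.factorial_succ,
    show α - 1 - n + 1 = α - n by ring, show α - 1 - 2 * n = α - 2 * n - 1 by ring,
    show ((K + 1 : ℕ) : ℝ) + ((1 : ℕ) : ℝ) / 2 - 1 = K + ((1 : ℕ) : ℝ) / 2 by push_cast; ring]
  have h1 : ((2 * n).factorial : ℝ) ≠ 0 := by positivity
  push_cast
  field_simp
  ring

theorem summable_oddTerm (K : ℕ) (α : ℝ) {r x : ℝ} (hr : r ∈ Set.Ioo (0 : ℝ) 1)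
    (hx : |x| < 1 - r) : Summable (oddTerm 1 K α x r) := by
  refine Summable.of_abs (Summable.of_nonneg_of_le (fun _ => abs_nonneg _) (fun n => ?_)
    ((summable_evenTerm K (α - 1) hr hx).abs.mul_left |2 * α * x * r|))
  rw [oddTerm_eq, abs_mul, abs_div]
  gcongr
  refine div_le_self (abs_nonneg _) ?_
  rw [abs_of_nonneg (by positivity)]
  linarith [(n.cast_nonneg : (0 : ℝ) ≤ n)]

/-! ### The case `m = 1` and the reduction to it. -/

theorem scalarSum_omegaSum_one (K : ℕ) (α : ℝ) {r x : ℝ} (hr : r ∈ Set.Ioo (0 : ℝ) 1)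
    (hx : |x| < 1 - r) :
    (1 ≤ K → Summable (evenTerm 1 K α x r) ∧
      scalarSum 1 K (α + K) x r
        = (constM 1 K α : ℂ) * ((∑' n : ℕ, evenTerm 1 K α x r n : ℝ) : ℂ)) ∧
    (Summable (oddTerm 1 K α x r) ∧
      omegaSum 1 K (α + K) x r
        = (constM 1 K α : ℂ) * ((∑' n : ℕ, oddTerm 1 K α x r n : ℝ) : ℂ)) := by
  refine ⟨fun hK => ?_, summable_oddTerm K α hr hx, ?_⟩
  · obtain ⟨K, rfl⟩ := Nat.exists_eq_add_of_le' hK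
    refine ⟨summable_evenTerm K α hr hx, ?_⟩
    rw [← Complex.ofReal_mul, ← tsum_mul_left, Complex.ofReal_tsum]
    exact (hasSum_constM_mul_evenTerm K α hr hx).tsum_eq.symm
  · rw [← Complex.ofReal_mul, ← tsum_mul_left, Complex.ofReal_tsum]
    exact (hasSum_constM_mul_oddTerm K α hr hx).tsum_eq.symm

theorem mainTheorem5 (m k : ℕ) (hm : Odd m) (α x₀ r : ℝ)
    (hr0 : 0 < r) (hr1 : r < 1) (hx₀ : |x₀| < 1 - r) :
    (1 ≤ k + (m - 1) / 2 →
      Summable (evenTerm m k α x₀ r) ∧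
      scalarSum m k (α + k + ((m : ℝ) - 1) / 2) x₀ r
        = (constM m k α : ℂ) * ((∑' n : ℕ, evenTerm m k α x₀ r n : ℝ) : ℂ)) ∧
    (Summable (oddTerm m k α x₀ r) ∧
      omegaSum m k (α + k + ((m : ℝ) - 1) / 2) x₀ r
        = (constM m k α : ℂ) * ((∑' n : ℕ, oddTerm m k α x₀ r n : ℝ) : ℂ)) := by
  -- With `m = 2p + 1`, each ingredient depends on `k` and `p` only through `k + p`.
  obtain ⟨p, rfl⟩ := hm
  have h := scalarSum_omegaSum_one (k + p) α ⟨hr0, hr1⟩ hx₀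
  have e0 : k + (2 * p + 1 - 1) / 2 = k + p := by omega
  have e0' : k + p + (1 - 1) / 2 = k + p := by omega
  have e1 : 2 * k + (2 * p + 1) = 2 * (k + p) + 1 := by ring
  have e2 : α + k + (((2 * p + 1 : ℕ) : ℝ) - 1) / 2 = α + (k + p : ℕ) := by push_cast; ring
  have e3 : constM (2 * p + 1) k α = constM 1 (k + p) α := by
    rw [constM, constM, e0, e0', show k + (2 * p + 1 + 1) / 2 = k + p + (1 + 1) / 2 by omega]
  have e4 : evenTerm (2 * p + 1) k α x₀ r = evenTerm 1 (k + p) α x₀ r := by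
    funext n
    rw [evenTerm, evenTerm, show (k : ℝ) + ((2 * p + 1 : ℕ) : ℝ) / 2 - 1
      = ((k + p : ℕ) : ℝ) + ((1 : ℕ) : ℝ) / 2 - 1 by push_cast; ring]
  have e5 : oddTerm (2 * p + 1) k α x₀ r = oddTerm 1 (k + p) α x₀ r := by
    funext n
    rw [oddTerm, oddTerm, show (k : ℝ) + ((2 * p + 1 : ℕ) : ℝ) / 2
      = ((k + p : ℕ) : ℝ) + ((1 : ℕ) : ℝ) / 2 by push_cast; ring]
  have e6 (β : ℝ) : scalarSum (2 * p + 1) k β x₀ r = scalarSum 1 (k + p) β x₀ r := by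
    simp only [scalarSum, coeffA, e0, e0', e1]
  have e7 (β : ℝ) : omegaSum (2 * p + 1) k β x₀ r = omegaSum 1 (k + p) β x₀ r := by
    simp only [omegaSum, coeffB, e0, e0', e1]
  rw [e0, e2, e3, e4, e5, e6, e7]
  exact h
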